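/- Let $[n]=\{1,\dots,n\}$. A hypergraph on a finite set $S$ is a collection of nonempty subsets of $S$ containing all singletons; it is discrete if its only members are the singletons. A hypergraph $B$ on $[n]$ is a building set if $I,J\in B$ and $I\cap J\neq\emptyset$ imply $I\cup J\in B$, and it is connected if $[n]\in B$. For $I\subseteq S$ and a hypergraph $B$ on $S$, let $B|_I=\{J\in B : J\subseteq I\}$, a hypergraph on $I$, and let $B/I$ be the hypergraph on $S\setminus I$ consisting of all nonempty $J\subseteq S\setminus I$ such that $J\in B$ or $I'\cup J\in B$ for some $I'\subseteq I$. The nestohedron of a building set $B$ on $[n]$ is the Minkowski sum $P_B=\sum_{I\in B}\mathrm{Conv}\{e_i : i\in I\}\subset\mathbb{R}^n$. For a polytope $Q\subset\mathbb{R}^n$, a function $f:[n]\to\{1,2,3,\dots\}$, viewed as the linear functional $x\mapsto\sum_i f(i)x_i$, is $Q$-generic if for some vertex $v$ of $Q$ it lies in the interior of the normal cone $\sigma_v=\{g\in(\mathbb{R}^n)^* : g(y)\le g(v)\text{ for all }y\in Q\}$. Let $$F(Q)=\sum_{f\ Q\text{-generic}} x_{f(1)}\cdots x_{f(n)},$$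 a formal power series in $x_1,x_2,\dots$ with integer coefficients. For a composition $\alpha=(a_1,\dots,a_k)\models n$ let $M_\alpha=\sum_{i_1<\cdots<i_k}x_{i_1}^{a_1}\cdots x_{i_k}^{a_k}$ be the monomial quasisymmetric function. **Proposition.** For every connected building set $B$ on $[n]$, $$F(P_B)=\sum_{\alpha\models n}\zeta_\alpha(B)\,M_\alpha,$$ where, for $\alpha=(a_1,\dots,a_k)$, $\zeta_\alpha(B)$ is the number of splitting chains of $B$ of type $\alpha$, that is, of chains $\emptyset=I_0\subset I_1\subset\cdots\subset I_k=[n]$ such that $(B|_{I_j})/I_{j-1}$ is discrete and $|I_j\setminus I_{j-1}|=a_j$ for all $1\le j\le k$. -/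

import Mathlib

namespace Nestohedra

/-- A hypergraph on the finite set `ground`: a collection of nonempty subsets of `ground`
containing all singletons. -/
structure FinHypergraph (V : Type*) where
  ground : Finset V
  edges : Finset (Finset V)
  subset_ground : ∀ J ∈ edges, J ⊆ ground
  nonempty_of_mem : ∀ J ∈ edges, J.Nonempty
  singleton_mem : ∀ i ∈ ground, {i} ∈ edges

namespace FinHypergraph

variable {V : Type*} [DecidableEq V]

/-- The induced subhypergraph `B|_I = {J ⊆ I | J ∈ B}`, a hypergraph on `I`
(on `ground ∩ I` if `I` is not contained in the ground set). -/
def restrict (B : FinHypergraph V) (I : Finset V) : FinHypergraph V where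
  ground := B.ground ∩ I
  edges := B.edges.filter (fun J => J ⊆ I)
  subset_ground := by
    intro J hJ
    rw [Finset.mem_filter] at hJ
    exact Finset.subset_inter (B.subset_ground J hJ.1) hJ.2
  nonempty_of_mem := by
    intro J hJ
    rw [Finset.mem_filter] at hJ
    exact B.nonempty_of_mem J hJ.1
  singleton_mem := by
    intro i hi
    rw [Finset.mem_inter] at hi
    rw [Finset.mem_filter, Finset.singleton_subset_iff]
    exact ⟨B.singleton_mem i hi.1, hi.2⟩

/-- The contraction `B / I`, a hypergraph on `ground \ I`: the nonempty `J ⊆ ground \ I` such that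
`J ∈ B`, or `I' ∪ J ∈ B` for some `I' ⊆ I`. -/
def contract (B : FinHypergraph V) (I : Finset V) : FinHypergraph V where
  ground := B.ground \ I
  edges := (B.ground \ I).powerset.filter
    (fun J => J.Nonempty ∧ (J ∈ B.edges ∨ ∃ I' ∈ I.powerset, I' ∪ J ∈ B.edges))
  subset_ground := by
    intro J hJ
    rw [Finset.mem_filter, Finset.mem_powerset] at hJ
    exact hJ.1
  nonempty_of_mem := by
    intro J hJ
    rw [Finset.mem_filter] at hJ
    exact hJ.2.1
  singleton_mem := by
    intro i hi
    rw [Finset.mem_filter, Finset.mem_powerset, Finset.singleton_subset_iff]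
    exact ⟨hi, Finset.singleton_nonempty i,
      Or.inl (B.singleton_mem i (Finset.mem_sdiff.mp hi).1)⟩

/-- A building set: `I, J ∈ B` and `I ∩ J ≠ ∅` imply `I ∪ J ∈ B`. -/
def IsBuildingSet (B : FinHypergraph V) : Prop :=
  ∀ I ∈ B.edges, ∀ J ∈ B.edges, (I ∩ J).Nonempty → I ∪ J ∈ B.edges

/-- `B` is connected if its whole ground set is a member of `B`. -/
def IsConnected (B : FinHypergraph V) : Prop := B.ground ∈ B.edges

/-- `B` is discrete if its only members are singletons. -/
def IsDiscrete (B : FinHypergraph V) : Prop := ∀ J ∈ B.edges, J.card = 1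

/-- A chain `∅ = I_0 ⊂ I_1 ⊂ ⋯ ⊂ I_k = ground` is splitting if every `(B|_{I_j}) / I_{j-1}` is
discrete. -/
structure IsSplittingChain (B : FinHypergraph V) {k : ℕ} (I : Fin (k + 1) → Finset V) : Prop where
  zero_eq : I 0 = ∅
  last_eq : I (Fin.last k) = B.ground
  ssubset : ∀ j : Fin k, I j.castSucc ⊂ I j.succ
  discrete : ∀ j : Fin k, ((B.restrict (I j.succ)).contract (I j.castSucc)).IsDiscrete

/-- The number `ζ_α(B)` of splitting chains of `B` of type `α = (a_1, …, a_k)`, that is, with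
`|I_j \ I_{j-1}| = a_j` for all `j`. -/
noncomputable def zeta (B : FinHypergraph V) {n : ℕ} (α : Composition n) : ℕ :=
  Set.ncard {I : Fin (α.length + 1) → Finset V |
    B.IsSplittingChain I ∧ ∀ j : Fin α.length, (I j.succ \ I j.castSucc).card = α.blocksFun j}

open scoped Pointwise in
/-- The polytope `P_B ⊆ ℝ^V`: the Minkowski sum over `I ∈ B` of the simplices
`Δ_I = Conv {e_i | i ∈ I}`. -/
def polytope (B : FinHypergraph V) : Set (V → ℝ) :=
  ∑ I ∈ B.edges, convexHull ℝ ((fun i : V => (Pi.single i 1 : V → ℝ)) '' (I : Set V))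

end FinHypergraph

/-- The (closed) normal cone `σ_v` of `Q ⊆ ℝⁿ` at `v`: the linear functionals, written in
coordinates, whose maximum over `Q` is attained at `v`. -/
def normalCone {n : ℕ} (Q : Set (Fin n → ℝ)) (v : Fin n → ℝ) : Set (Fin n → ℝ) :=
  {g | ∀ y ∈ Q, g ⬝ᵥ y ≤ g ⬝ᵥ v}

/-- `f : [n] → {1, 2, …}` is `Q`-generic if it lies in the interior of the normal cone of `Q` at
some vertex of `Q`. -/
def IsGeneric {n : ℕ} (Q : Set (Fin n → ℝ)) (f : Fin n → ℕ+) : Prop :=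
  ∃ v ∈ Q.extremePoints ℝ, (fun i => ((f i : ℕ) : ℝ)) ∈ interior (normalCone Q v)

/-- The formal sum `∑_a x^{m(a)}` of a family of monomials in `x_1, x_2, …` in which every monomial
occurs finitely often: its coefficient at `d` is the number of `a` with `m(a) = d`. -/
noncomputable def monomialSum {A : Type*} (m : A → (ℕ+ →₀ ℕ)) : MvPowerSeries ℕ+ ℤ :=
  fun d => ((Set.ncard {a | m a = d} : ℕ) : ℤ)

/-- The exponent of the monomial `x_f = x_{f(1)} ⋯ x_{f(n)}`. -/
noncomputable def exponent {n : ℕ} (f : Fin n → ℕ+) : ℕ+ →₀ ℕ :=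
  ∑ i, Finsupp.single (f i) 1

/-- The exponent of the monomial `x_{i_1}^{a_1} ⋯ x_{i_k}^{a_k}`. -/
noncomputable def compExponent {n : ℕ} (α : Composition n) (i : Fin α.length → ℕ+) : ℕ+ →₀ ℕ :=
  ∑ j, Finsupp.single (i j) (α.blocksFun j)

/-- `F(Q) = ∑ x_f`, the sum over all `Q`-generic functions `f`. -/
noncomputable def genericEnumerator {n : ℕ} (Q : Set (Fin n → ℝ)) : MvPowerSeries ℕ+ ℤ :=
  monomialSum (fun f : {f : Fin n → ℕ+ // IsGeneric Q f} => exponent f.1)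

/-- The monomial quasisymmetric function
`M_α = ∑_{i_1 < ⋯ < i_k} x_{i_1}^{a_1} ⋯ x_{i_k}^{a_k}`. -/
noncomputable def monomialQSym {n : ℕ} (α : Composition n) : MvPowerSeries ℕ+ ℤ :=
  monomialSum (fun i : {i : Fin α.length → ℕ+ // StrictMono i} => compExponent α i.1)

/-- Every monomial occurs finitely often in the sum defining `M_α`. -/
theorem finite_compExponent_eq {n : ℕ} (α : Composition n) (d : ℕ+ →₀ ℕ) :
    {i : Fin α.length → ℕ+ | compExponent α i = d}.Finite := by
  refine (Set.Finite.pi' (fun _ : Fin α.length => d.support.finite_toSet)).subset ?_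
  rintro i rfl j
  have h : α.blocksFun j ≤ compExponent α i (i j) := by
    rw [compExponent, Finsupp.finsetSum_apply]
    calc α.blocksFun j = Finsupp.single (i j) (α.blocksFun j) (i j) := by simp
      _ ≤ _ := Finset.single_le_sum
        (f := fun l => (Finsupp.single (i l) (α.blocksFun l) : ℕ+ →₀ ℕ) (i j))
        (fun _ _ => Nat.zero_le _) (Finset.mem_univ j)
  have h1 := α.one_le_blocksFun j
  simp only [Finset.mem_coe, Finsupp.mem_support_iff]
  omega

/-- Every monomial occurs finitely often in the sum defining `F(Q)`. -/
theorem finite_exponent_eq {n : ℕ} (d : ℕ+ →₀ ℕ) :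
    {f : Fin n → ℕ+ | exponent f = d}.Finite := by
  refine (Set.Finite.pi' (fun _ : Fin n => d.support.finite_toSet)).subset ?_
  rintro f rfl j
  have h : 1 ≤ exponent f (f j) := by
    rw [exponent, Finsupp.finsetSum_apply]
    calc 1 = Finsupp.single (f j) 1 (f j) := by simp
      _ ≤ _ := Finset.single_le_sum
        (f := fun l => (Finsupp.single (f l) 1 : ℕ+ →₀ ℕ) (f j))
        (fun _ _ => Nat.zero_le _) (Finset.mem_univ j)
  simp only [Finset.mem_coe, Finsupp.mem_support_iff]
  omega

end Nestohedra

namespace Nestohedra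

open Finset

/-! Everything reduces to one condition: `f` has a unique maximum on each edge of `B`. Maximizing
`f` over a Minkowski sum means maximizing it over each summand, and on `Conv {e_i | i ∈ I}` the
maximal face is spanned by the `e_i` with `f i` maximal on `I`. So `f` is `P_B`-generic exactly when
the condition holds (`isGeneric_polytope_iff`). The condition depends only on the order of the
values. Write `f = i ∘ g` with `i` strictly increasing and `g` onto `{1, …, k}`: the monomial of `f`
fixes `i` and the fibre sizes `α` of `g`, while the sublevel sets of `g` form a chain of type `α`.
That chain is splitting exactly when `g` satisfies the condition (`hasUniqueMax_iff_discrete`).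
Hence each monomial of `M_α` arises from `ζ_α(B)` generic functions, and each monomial of degree `n`
lies in exactly one `M_α`. -/

/-- `f` attains its maximum exactly once on every edge of `B`. -/
def FinHypergraph.HasUniqueMax {V L : Type*} [LT L] (B : FinHypergraph V) (f : V → L) : Prop :=
  ∀ I ∈ B.edges, ∃ x ∈ I, ∀ y ∈ I, y ≠ x → f y < f x

theorem FinHypergraph.hasUniqueMax_comp_iff {V L M : Type*} [LinearOrder L] [Preorder M]
    (B : FinHypergraph V) {φ : L → M} (hφ : StrictMono φ) (f : V → L) :
    B.HasUniqueMax (φ ∘ f) ↔ B.HasUniqueMax f := by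
  simp only [FinHypergraph.HasUniqueMax, Function.comp_apply, hφ.lt_iff_lt]

/-! ### Generic functionals on the nestohedron. -/

section Polytope

variable {n : ℕ}

/-- The simplex `Conv {e_i | i ∈ I}`. -/
abbrev simplexOn (I : Finset (Fin n)) : Set (Fin n → ℝ) :=
  convexHull ℝ ((fun i : Fin n => (Pi.single i 1 : Fin n → ℝ)) '' (I : Set (Fin n)))

theorem dotProduct_le_of_mem_simplexOn {I : Finset (Fin n)} {f y : Fin n → ℝ} {c : ℝ}
    (hc : ∀ i ∈ I, f i ≤ c) (hy : y ∈ simplexOn I) : f ⬝ᵥ y ≤ c := by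
  have hconv : Convex ℝ {z : Fin n → ℝ | f ⬝ᵥ z ≤ c} := by
    intro a ha b hb s t hs ht hst
    simp only [Set.mem_ofPred_eq, dotProduct_add, dotProduct_smul, smul_eq_mul] at *
    calc s * (f ⬝ᵥ a) + t * (f ⬝ᵥ b) ≤ s * c + t * c := by gcongr
      _ = c := by rw [← add_mul, hst, one_mul]
  refine convexHull_min ?_ hconv hy
  rintro _ ⟨i, hi, rfl⟩
  simpa using hc i hi

theorem single_mem_simplexOn {I : Finset (Fin n)} {i : Fin n} (hi : i ∈ I) :
    (Pi.single i 1 : Fin n → ℝ) ∈ simplexOn I :=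
  subset_convexHull ℝ _ ⟨i, hi, rfl⟩

theorem nonneg_and_sum_eq_one_of_mem_simplexOn {I : Finset (Fin n)} {y : Fin n → ℝ}
    (hy : y ∈ simplexOn I) : (∀ i, 0 ≤ y i) ∧ (∀ i ∉ I, y i = 0) ∧ ∑ i, y i = 1 := by
  have hconv : Convex ℝ
      {z : Fin n → ℝ | (∀ i, 0 ≤ z i) ∧ (∀ i ∉ I, z i = 0) ∧ ∑ i, z i = 1} := by
    rintro a ⟨ha, ha', ha''⟩ b ⟨hb, hb', hb''⟩ s t hs ht hst
    refine ⟨fun i => ?_, fun i hi => ?_, ?_⟩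
    · have := ha i
      have := hb i
      simp only [Pi.add_apply, Pi.smul_apply, smul_eq_mul]
      positivity
    · simp [ha' i hi, hb' i hi]
    · simp [sum_add_distrib, ← mul_sum, ha'', hb'', hst]
  refine convexHull_min ?_ hconv hy
  rintro _ ⟨i, hi, rfl⟩
  refine ⟨fun j => ?_, fun j hj => ?_, by simp⟩
  · by_cases h : j = i <;> simp [h]
  · have : j ≠ i := by rintro rfl; exact hj hi
    simp [this]

/-- A linear functional with a strict maximum over `I` at `m` is maximized on the simplex of `I`
only at `e_m`. -/
theorem eq_single_of_le_dotProduct {I : Finset (Fin n)} {f y : Fin n → ℝ} {m : Fin n}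
    (hm : ∀ j ∈ I, j ≠ m → f j < f m) (hy : y ∈ simplexOn I) (hle : f m ≤ f ⬝ᵥ y) :
    y = Pi.single m 1 := by
  obtain ⟨h0, hI, h1⟩ := nonneg_and_sum_eq_one_of_mem_simplexOn hy
  have hterm : ∀ j ∈ (univ : Finset (Fin n)), 0 ≤ (f m - f j) * y j := by
    intro j _
    by_cases hj : j ∈ I
    · refine mul_nonneg ?_ (h0 j)
      by_cases hjm : j = m
      · simp [hjm]
      · exact (sub_pos.2 (hm j hj hjm)).le
    · simp [hI j hj]
  have hsum : ∑ j, (f m - f j) * y j = f m - f ⬝ᵥ y := by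
    simp only [sub_mul, sum_sub_distrib, ← mul_sum, h1, mul_one, dotProduct]
  have hzero : ∀ j, (f m - f j) * y j = 0 := by
    have hs : ∑ j, (f m - f j) * y j = 0 :=
      le_antisymm (by rw [hsum]; linarith) (sum_nonneg hterm)
    exact fun j => (sum_eq_zero_iff_of_nonneg hterm).1 hs j (mem_univ j)
  have hne : ∀ j, j ≠ m → y j = 0 := by
    intro j hjm
    by_cases hj : j ∈ I
    · exact (mul_eq_zero.1 (hzero j)).resolve_left (sub_pos.2 (hm j hj hjm)).ne'
    · exact hI j hj
  funext j
  by_cases hjm : j = m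
  · subst hjm
    rw [Pi.single_eq_same, ← h1]
    exact (sum_eq_single j (fun b _ hb => hne b hb) (by simp)).symm
  · rw [hne j hjm, Pi.single_eq_of_ne hjm]

theorem FinHypergraph.mem_polytope_iff {B : FinHypergraph (Fin n)} {y : Fin n → ℝ} :
    y ∈ B.polytope ↔
      ∃ g : Finset (Fin n) → Fin n → ℝ, (∀ I ∈ B.edges, g I ∈ simplexOn I) ∧
        ∑ I ∈ B.edges, g I = y := by
  rw [FinHypergraph.polytope, Set.mem_finsetSum]
  constructor
  · rintro ⟨g, hg, hy⟩
    exact ⟨g, fun I hI => hg hI, hy⟩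
  · rintro ⟨g, hg, hy⟩
    exact ⟨g, fun {I} hI => hg I hI, hy⟩

/-- For small `t > 0` the functional `f + t (y - v)` is still in the cone; comparing its values at
`y` and `v` gives `f ⬝ᵥ y + t |y - v|² ≤ f ⬝ᵥ v`. -/
theorem dotProduct_lt_of_mem_interior_normalCone {Q : Set (Fin n → ℝ)} {f v y : Fin n → ℝ}
    (hf : f ∈ interior (normalCone Q v)) (hy : y ∈ Q) (hyv : y ≠ v) : f ⬝ᵥ y < f ⬝ᵥ v := by
  have hcont : Filter.Tendsto (fun t : ℝ => f + t • (y - v)) (nhds 0) (nhds f) := by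
    have : Continuous fun t : ℝ => f + t • (y - v) := by fun_prop
    simpa using this.tendsto 0
  have hev := hcont.eventually (mem_interior_iff_mem_nhds.1 hf)
  obtain ⟨ε, hε, hball⟩ := Metric.eventually_nhds_iff.1 hev
  have hmem := hball (y := ε / 2) (by rw [Real.dist_eq, sub_zero, abs_of_pos (half_pos hε)]; linarith)
  have h := hmem y hy
  have hpos : 0 < (y - v) ⬝ᵥ (y - v) := by
    have hne : y - v ≠ 0 := sub_ne_zero.2 hyv
    have h0 : 0 ≤ (y - v) ⬝ᵥ (y - v) := sum_nonneg fun i _ => mul_self_nonneg _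
    exact lt_of_le_of_ne h0 fun h => hne (dotProduct_self_eq_zero.1 h.symm)
  have hmul : 0 < ε / 2 * ((y - v) ⬝ᵥ (y - v)) := mul_pos (half_pos hε) hpos
  simp only [add_dotProduct, smul_dotProduct, smul_eq_mul] at h
  rw [dotProduct_sub, mul_sub] at hmul
  linarith

theorem mem_extremePoints_of_strict_max {Q : Set (Fin n → ℝ)} {f v : Fin n → ℝ} (hv : v ∈ Q)
    (hmax : ∀ y ∈ Q, y ≠ v → f ⬝ᵥ y < f ⬝ᵥ v) : v ∈ Q.extremePoints ℝ := by
  refine ⟨hv, fun a ha b hb hab => ?_⟩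
  obtain ⟨s, t, hs, ht, hst, hv'⟩ := hab
  by_contra hne
  have ha' : f ⬝ᵥ a < f ⬝ᵥ v := hmax a ha hne
  have hb' : f ⬝ᵥ b ≤ f ⬝ᵥ v := by
    by_cases h : b = v
    · rw [h]
    · exact (hmax b hb h).le
  have h : f ⬝ᵥ v = s * (f ⬝ᵥ a) + t * (f ⬝ᵥ b) := by
    rw [← hv', dotProduct_add, dotProduct_smul, dotProduct_smul, smul_eq_mul, smul_eq_mul]
  have h1 : s * (f ⬝ᵥ a) < s * (f ⬝ᵥ v) := mul_lt_mul_of_pos_left ha' hs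
  have h2 : t * (f ⬝ᵥ b) ≤ t * (f ⬝ᵥ v) := mul_le_mul_of_nonneg_left hb' ht.le
  have h3 : s * (f ⬝ᵥ v) + t * (f ⬝ᵥ v) = f ⬝ᵥ v := by rw [← add_mul, hst, one_mul]
  linarith

/-- A functional in the interior of the normal cone of some point of `P_B` has a unique maximum
on every edge. -/
theorem FinHypergraph.hasUniqueMax_of_mem_interior_normalCone {B : FinHypergraph (Fin n)}
    {f v : Fin n → ℝ} (hv : v ∈ B.polytope) (hf : f ∈ interior (normalCone B.polytope v)) :
    B.HasUniqueMax f := by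
  classical
  intro I hI
  obtain ⟨g, hg, hgv⟩ := FinHypergraph.mem_polytope_iff.1 hv
  obtain ⟨x, hx, hmax⟩ := I.exists_max_image f (B.nonempty_of_mem I hI)
  -- Exchange argument: replacing the summand of `v` at `I` by `e_z`, for a maximizer `z`, cannot
  -- lower the value of `f`. Since `v` is the strict maximum on the polytope, the point is
  -- unchanged, so that summand was already `e_z`. Two maximizers would give two different vectors.
  have key : ∀ z ∈ I, f x ≤ f z → g I = Pi.single z 1 := by
    intro z hz hxz
    have hmem : ∑ J ∈ B.edges, Function.update g I (Pi.single z 1) J ∈ B.polytope := by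
      refine FinHypergraph.mem_polytope_iff.2 ⟨_, fun J hJ => ?_, rfl⟩
      by_cases h : J = I
      · subst h
        simpa using single_mem_simplexOn hz
      · simpa [Function.update_of_ne h] using hg J hJ
    have hsum : ∑ J ∈ B.edges, Function.update g I (Pi.single z 1) J + g I =
        v + Pi.single z 1 := by
      rw [sum_update_of_mem hI, ← hgv, ← add_sum_erase _ _ hI, sdiff_singleton_eq_erase]
      abel
    have hle : f ⬝ᵥ g I ≤ f z :=
      dotProduct_le_of_mem_simplexOn (fun i hi => (hmax i hi).trans hxz) (hg I hI)
    have heq : ∑ J ∈ B.edges, Function.update g I (Pi.single z 1) J = v := by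
      by_contra hne
      have hlt := dotProduct_lt_of_mem_interior_normalCone hf hmem hne
      have := congrArg (fun y => f ⬝ᵥ y) hsum
      simp only [dotProduct_add, dotProduct_single, mul_one] at this
      linarith
    rw [heq] at hsum
    exact add_left_cancel hsum
  refine ⟨x, hx, fun y hy hyx => lt_of_not_ge fun hxy => hyx ?_⟩
  have h := (key y hy hxy).symm.trans (key x hx le_rfl)
  by_contra hne
  have := congrFun h y
  simp [hne] at this

/-- For the converse, the vertex is the sum over the edges of `e_m`, with `m` the maximizer on the
edge. The inequalities making each `m` a strict maximizer are finitely many open conditions, so they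
persist near `f`. -/
theorem FinHypergraph.isGeneric_polytope_iff {B : FinHypergraph (Fin n)} {f : Fin n → ℕ+} :
    IsGeneric B.polytope f ↔ B.HasUniqueMax f := by
  have hcast : StrictMono fun a : ℕ+ => ((a : ℕ) : ℝ) := fun a b hab => by
    simpa using hab
  rw [← B.hasUniqueMax_comp_iff hcast f]
  constructor
  · rintro ⟨v, hv, hf⟩
    exact FinHypergraph.hasUniqueMax_of_mem_interior_normalCone hv.1 hf
  · intro h
    change ∃ v ∈ B.polytope.extremePoints ℝ,
      ((fun a : ℕ+ => ((a : ℕ) : ℝ)) ∘ f) ∈ interior (normalCone B.polytope v)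
    generalize ((fun a : ℕ+ => ((a : ℕ) : ℝ)) ∘ f) = F at h ⊢
    -- The membership hypothesis sits inside the existential so that `choose` yields a function on
    -- all finsets; its value off the edges never matters.
    have h' : ∀ I : Finset (Fin n), ∃ x : Fin n → ℝ, I ∈ B.edges →
        ∃ m ∈ I, x = Pi.single m 1 ∧ ∀ y ∈ I, y ≠ m → F y < F m := by
      intro I
      by_cases hI : I ∈ B.edges
      · obtain ⟨m, hm, hm'⟩ := h I hI
        exact ⟨Pi.single m 1, fun _ => ⟨m, hm, rfl, hm'⟩⟩
      · exact ⟨0, fun h => absurd h hI⟩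
    choose e he using h'
    have hmem : ∑ I ∈ B.edges, e I ∈ B.polytope := by
      refine FinHypergraph.mem_polytope_iff.2 ⟨e, fun I hI => ?_, rfl⟩
      obtain ⟨m, hm, hem, -⟩ := he I hI
      rw [hem]
      exact single_mem_simplexOn hm
    refine ⟨∑ I ∈ B.edges, e I, mem_extremePoints_of_strict_max (f := F) hmem ?_, ?_⟩
    · intro y hy hne
      obtain ⟨g, hg, rfl⟩ := FinHypergraph.mem_polytope_iff.1 hy
      have hle : ∀ I ∈ B.edges, F ⬝ᵥ g I ≤ F ⬝ᵥ e I := by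
        intro I hI
        obtain ⟨m, hm, hem, hlt⟩ := he I hI
        rw [hem, dotProduct_single, mul_one]
        refine dotProduct_le_of_mem_simplexOn (fun i hi => ?_) (hg I hI)
        by_cases him : i = m
        · rw [him]
        · exact (hlt i hi him).le
      rw [dotProduct_sum, dotProduct_sum]
      refine sum_lt_sum hle ?_
      -- If no summand lost value, each would be the unique maximizer on its simplex, forcing `y` to
      -- be the vertex.
      by_contra! hge
      refine hne (sum_congr rfl fun I hI => ?_)
      obtain ⟨m, hm, hem, hlt⟩ := he I hI
      have := hge I hI
      rw [hem, dotProduct_single, mul_one] at this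
      rw [hem]
      exact eq_single_of_le_dotProduct hlt (hg I hI) this
    · rw [mem_interior_iff_mem_nhds]
      have hev : ∀ᶠ G : Fin n → ℝ in nhds F, ∀ I ∈ B.edges, ∃ m ∈ I, e I = Pi.single m 1 ∧
          ∀ y ∈ I, y ≠ m → G y < G m := by
        rw [Filter.eventually_all_finset]
        intro I hI
        obtain ⟨m, hm, hem, hlt⟩ := he I hI
        have : ∀ᶠ G : Fin n → ℝ in nhds F, ∀ y ∈ I, y ≠ m → G y < G m := by
          rw [Filter.eventually_all_finset]
          intro y hy
          by_cases hym : y = m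
          · exact Filter.Eventually.of_forall fun G hne => absurd hym hne
          · have hopen : IsOpen {G : Fin n → ℝ | G y < G m} :=
              isOpen_lt (continuous_apply y) (continuous_apply m)
            filter_upwards [hopen.mem_nhds (hlt y hy hym)] with G hG _ using hG
        filter_upwards [this] with G hG using ⟨m, hm, hem, hG⟩
      filter_upwards [hev] with G hG y hy
      obtain ⟨g, hg, rfl⟩ := FinHypergraph.mem_polytope_iff.1 hy
      rw [dotProduct_sum, dotProduct_sum]
      refine sum_le_sum fun I hI => ?_
      obtain ⟨m, hm, hem, hlt⟩ := hG I hI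
      rw [hem, dotProduct_single, mul_one]
      refine dotProduct_le_of_mem_simplexOn (fun i hi => ?_) (hg I hI)
      by_cases him : i = m
      · rw [him]
      · exact (hlt i hi him).le

end Polytope

/-! ### Each monomial of degree `n` determines its composition and its indices. -/

section Exponents

variable {n : ℕ}

theorem exponent_apply (f : Fin n → ℕ+) (a : ℕ+) :
    exponent f a = #{x | f x = a} := by
  rw [exponent, Finsupp.finsetSum_apply, card_filter]
  simp only [Finsupp.single_apply]

theorem compExponent_apply {α : Composition n} {i : Fin α.length → ℕ+}
    (hi : Function.Injective i) (j : Fin α.length) : compExponent α i (i j) = α.blocksFun j := by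
  simp [compExponent, Finsupp.single_apply, hi.eq_iff]

theorem compExponent_apply_of_notMem_range {α : Composition n} {i : Fin α.length → ℕ+} {a : ℕ+}
    (ha : a ∉ Set.range i) : compExponent α i a = 0 := by
  rw [compExponent, Finsupp.finsetSum_apply]
  exact sum_eq_zero fun j _ => Finsupp.single_eq_of_ne fun h => ha ⟨j, h.symm⟩

theorem mem_support_compExponent {α : Composition n} {i : Fin α.length → ℕ+}
    (hi : Function.Injective i) {a : ℕ+} : a ∈ (compExponent α i).support ↔ a ∈ Set.range i := by
  rw [Finsupp.mem_support_iff]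
  constructor
  · exact fun h => by_contra fun ha => h (compExponent_apply_of_notMem_range ha)
  · rintro ⟨j, rfl⟩
    rw [compExponent_apply hi]
    exact Nat.one_le_iff_ne_zero.1 (α.one_le_blocksFun j)

/-- Parts of a composition are positive, so the support of the monomial is exactly the set of
indices; listing it in increasing order recovers `i`, and its exponents then recover `α`. -/
theorem ofFn_eq_sort_support {α : Composition n} {i : Fin α.length → ℕ+} (hi : StrictMono i) :
    List.ofFn i = (compExponent α i).support.sort (· ≤ ·) := by
  have h1 : (List.ofFn i).SortedLT := hi.sortedLT_ofFn
  refine List.Perm.eq_of_pairwise' (r := (· ≤ ·)) h1.sortedLE.pairwise (pairwise_sort _ _) ?_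
  refine (List.perm_ext_iff_of_nodup h1.nodup (sort_nodup _ _)).2 fun a => ?_
  rw [mem_sort, mem_support_compExponent hi.injective, List.mem_ofFn, Set.mem_range]

theorem blocks_eq_map_sort_support {α : Composition n} {i : Fin α.length → ℕ+}
    (hi : StrictMono i) :
    α.blocks = ((compExponent α i).support.sort (· ≤ ·)).map (compExponent α i) := by
  rw [← ofFn_eq_sort_support hi, List.map_ofFn, ← α.ofFn_blocksFun]
  congr 1
  funext j
  exact (compExponent_apply hi.injective j).symm

theorem composition_eq_of_compExponent_eq {α β : Composition n} {i : Fin α.length → ℕ+}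
    {j : Fin β.length → ℕ+} (hi : StrictMono i) (hj : StrictMono j)
    (h : compExponent α i = compExponent β j) : α = β := by
  apply Composition.ext
  rw [blocks_eq_map_sort_support hi, blocks_eq_map_sort_support hj, h]

theorem eq_of_compExponent_eq {α : Composition n} {i j : Fin α.length → ℕ+}
    (hi : StrictMono i) (hj : StrictMono j) (h : compExponent α i = compExponent α j) :
    i = j := by
  apply List.ofFn_injective
  rw [ofFn_eq_sort_support hi, ofFn_eq_sort_support hj, h]

/-- Take for `i` the values of `f` in increasing order and for `α` the sizes of their fibres. -/
theorem exists_compExponent_eq_exponent (f : Fin n → ℕ+) :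
    ∃ (α : Composition n) (i : Fin α.length → ℕ+), StrictMono i ∧
      compExponent α i = exponent f := by
  set d := exponent f with hd
  set l := d.support.sort (· ≤ ·) with hl
  have hsum : (l.map d).sum = n := by
    have h1 : (l.map d).sum = ∑ a ∈ d.support, d a := by
      conv_rhs => rw [← sort_toFinset d.support (· ≤ ·)]
      rw [List.sum_toFinset _ (sort_nodup _ _)]
    rw [h1]
    have h2 : ∀ x ∈ (univ : Finset (Fin n)), f x ∈ d.support := by
      intro x _
      rw [Finsupp.mem_support_iff, hd, exponent_apply]
      exact (card_pos.2 ⟨x, by simp⟩).ne'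
    have := card_eq_sum_card_fiberwise (f := f) (s := univ) (t := d.support)
      (fun x hx => h2 x hx)
    simp only [card_univ, Fintype.card_fin] at this
    rw [this]
    exact sum_congr rfl fun a _ => by rw [hd, exponent_apply]
  let α : Composition n :=
    { blocks := l.map d
      blocks_pos := by
        intro b hb
        obtain ⟨a, ha, rfl⟩ := List.mem_map.1 hb
        exact Nat.pos_of_ne_zero (Finsupp.mem_support_iff.1 ((mem_sort _).1 ha))
      blocks_sum := hsum }
  have hlen : α.length = l.length := List.length_map _
  let i : Fin α.length → ℕ+ := fun j => l.get (Fin.cast hlen j)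
  have hi : StrictMono i := fun a b hab => (sortedLT_sort d.support).strictMono_get hab
  refine ⟨α, i, hi, ?_⟩
  have hblock : ∀ j, α.blocksFun j = d (i j) := fun j => by
    simp [α, i, Composition.blocksFun]
  ext a
  by_cases ha : a ∈ Set.range i
  · obtain ⟨j, rfl⟩ := ha
    rw [compExponent_apply hi.injective, hblock]
  · rw [compExponent_apply_of_notMem_range ha]
    by_contra hne
    have hal : a ∈ l := (mem_sort _).2 (Finsupp.mem_support_iff.2 (Ne.symm hne))
    obtain ⟨j, hj⟩ := List.get_of_mem hal
    exact ha ⟨Fin.cast hlen.symm j, hj⟩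

end Exponents

/-! ### Splitting chains as sublevel sets. -/

section Chains

variable {n : ℕ}

/-- The maps to `Fin k` with a unique maximum on every edge of `B` and fibres of sizes `a_j`. -/
def uniqueMaxMaps (B : FinHypergraph (Fin n)) (α : Composition n) : Set (Fin n → Fin α.length) :=
  {g | B.HasUniqueMax g ∧ ∀ j, #{x | g x = j} = α.blocksFun j}

/-- The increasing chain of sublevel sets of a map to `Fin k`. -/
def sublevelChain {k : ℕ} (g : Fin n → Fin k) (j : Fin (k + 1)) : Finset (Fin n) :=
  {x | (g x).castSucc < j}

theorem mem_sublevelChain {k : ℕ} {g : Fin n → Fin k} {j : Fin (k + 1)} {x : Fin n} :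
    x ∈ sublevelChain g j ↔ (g x).castSucc < j := by
  simp [sublevelChain]

theorem sublevelChain_injective {k : ℕ} :
    Function.Injective (sublevelChain : (Fin n → Fin k) → Fin (k + 1) → Finset (Fin n)) := by
  intro g h hgh
  have key : ∀ x j, (g x).castSucc < j ↔ (h x).castSucc < j := fun x j => by
    rw [← mem_sublevelChain, hgh, mem_sublevelChain]
  funext x
  have h1 := (key x (h x).succ).2 Fin.castSucc_lt_succ
  have h2 := (key x (g x).succ).1 Fin.castSucc_lt_succ
  rw [Fin.castSucc_lt_succ_iff] at h1 h2
  exact le_antisymm h1 h2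

theorem sublevelChain_succ_sdiff {k : ℕ} (g : Fin n → Fin k) (j : Fin k) :
    sublevelChain g j.succ \ sublevelChain g j.castSucc = ({x | g x = j} : Finset (Fin n)) := by
  ext x
  simp only [mem_sdiff, mem_sublevelChain, Fin.castSucc_lt_succ_iff, Fin.castSucc_lt_castSucc_iff,
    not_lt, mem_filter_univ]
  exact ⟨fun h => le_antisymm h.1 h.2, fun h => ⟨h.le, h.ge⟩⟩

/-- The edges of the `j`-th contraction are the top levels `{y ∈ I | g y = j}` of the edges `I` on
which `g` has maximum `j`; discreteness says that each top level is a single point. -/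
theorem FinHypergraph.hasUniqueMax_iff_discrete {B : FinHypergraph (Fin n)}
    (hB : B.ground = univ) {k : ℕ} (g : Fin n → Fin k) :
    B.HasUniqueMax g ↔ ∀ j : Fin k, ((B.restrict (sublevelChain g j.succ)).contract
      (sublevelChain g j.castSucc)).IsDiscrete := by
  constructor
  · intro h j J hJ
    simp only [FinHypergraph.contract, FinHypergraph.restrict, mem_filter, mem_powerset, hB,
      univ_inter, sublevelChain_succ_sdiff] at hJ
    obtain ⟨hJj, hne, hJ⟩ := hJ
    have hlev : ∀ x ∈ J, g x = j := fun x hx => by simpa using hJj hx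
    obtain ⟨I', hI', hmem⟩ : ∃ I' ⊆ sublevelChain g j.castSucc, I' ∪ J ∈ B.edges := by
      rcases hJ with hJ | ⟨I', hI', hJ⟩
      · exact ⟨∅, empty_subset _, by simpa using hJ.1⟩
      · exact ⟨I', hI', hJ.1⟩
    obtain ⟨x, hx, hmax⟩ := h _ hmem
    refine card_eq_one.2 ⟨x, (eq_singleton_iff_nonempty_unique_mem).2 ⟨hne, fun y hy => ?_⟩⟩
    by_contra hyx
    have hlt := hmax y (mem_union_right _ hy) hyx
    rw [hlev y hy] at hlt
    rcases mem_union.1 hx with hx | hx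
    · have := mem_sublevelChain.1 (hI' hx)
      rw [Fin.castSucc_lt_castSucc_iff] at this
      exact lt_asymm hlt this
    · exact hlt.ne (hlev x hx).symm
  · intro h I hI
    obtain ⟨x, hx, hmax⟩ := I.exists_max_image g (B.nonempty_of_mem I hI)
    have hcard := h (g x) (I.filter fun y => g y = g x) <| by
      simp only [FinHypergraph.contract, FinHypergraph.restrict, mem_filter, mem_powerset, hB,
        univ_inter, sublevelChain_succ_sdiff]
      refine ⟨filter_subset_filter _ (subset_univ _), ⟨x, by simp [hx]⟩, Or.inr
        ⟨I.filter fun y => ¬ g y = g x, fun y hy => ?_, ?_⟩⟩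
      · rw [mem_filter] at hy
        rw [mem_sublevelChain, Fin.castSucc_lt_castSucc_iff]
        exact lt_of_le_of_ne (hmax y hy.1) hy.2
      · rw [union_comm, filter_union_filter_not_eq]
        refine ⟨hI, fun y hy => ?_⟩
        rw [mem_sublevelChain, Fin.castSucc_lt_succ_iff]
        exact hmax y hy
    refine ⟨x, hx, fun y hy hyx => lt_of_le_of_ne (hmax y hy) fun heq => hyx ?_⟩
    exact card_le_one.1 hcard.le y (by simp [hy, heq]) x (by simp [hx])

/-- A chain of sets from `∅` to the whole set is the chain of sublevel sets of some map. -/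
theorem exists_sublevelChain_eq {k : ℕ} {I : Fin (k + 1) → Finset (Fin n)} (hI : Monotone I)
    (h0 : I 0 = ∅) (hlast : I (Fin.last k) = univ) : ∃ g : Fin n → Fin k, sublevelChain g = I := by
  -- Each `x` is outside the first set and inside the last, so some step adds it; `g x` is that
  -- step.
  have hstep : ∀ x, ∃ j : Fin k, x ∉ I j.castSucc ∧ x ∈ I j.succ := by
    intro x
    by_contra! hx
    have : ∀ j, x ∉ I j := Fin.induction (by simp [h0]) fun j hj => hx j hj
    exact this (Fin.last k) (by simp [hlast])
  choose g hg using hstep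
  refine ⟨g, funext fun j => Finset.ext fun x => ?_⟩
  rw [mem_sublevelChain]
  constructor
  · exact fun h => hI (Fin.castSucc_lt_iff_succ_le.1 h) (hg x).2
  · exact fun h => lt_of_not_ge fun hle => (hg x).1 (hI hle h)

theorem image_sublevelChain_uniqueMaxMaps {B : FinHypergraph (Fin n)} (hB : B.ground = univ)
    (α : Composition n) :
    sublevelChain '' uniqueMaxMaps B α = {I : Fin (α.length + 1) → Finset (Fin n) |
      B.IsSplittingChain I ∧
        ∀ j : Fin α.length, (I j.succ \ I j.castSucc).card = α.blocksFun j} := by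
  ext I
  constructor
  · rintro ⟨g, ⟨hmax, hcard⟩, rfl⟩
    have hdiff : ∀ j : Fin α.length,
        #(sublevelChain g j.succ \ sublevelChain g j.castSucc) = α.blocksFun j := fun j => by
      rw [sublevelChain_succ_sdiff, hcard]
    refine ⟨⟨?_, ?_, fun j => ?_, (B.hasUniqueMax_iff_discrete hB g).1 hmax⟩, hdiff⟩
    · ext x
      simp [mem_sublevelChain]
    · ext x
      simp [mem_sublevelChain, hB, Fin.castSucc_lt_last]
    · refine Finset.ssubset_iff_subset_ne.2 ⟨fun x hx => ?_, fun heq => ?_⟩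
      · rw [mem_sublevelChain] at hx ⊢
        exact hx.trans Fin.castSucc_lt_succ
      -- Inclusions are strict because parts of a composition are at least 1.
      · have := hdiff j
        rw [heq, sdiff_self, bot_eq_empty, card_empty] at this
        have := α.one_le_blocksFun j
        omega
  · rintro ⟨hI, hcard⟩
    obtain ⟨g, rfl⟩ := exists_sublevelChain_eq
      (Fin.strictMono_iff_lt_succ.2 hI.ssubset).monotone hI.zero_eq (hI.last_eq.trans hB)
    refine ⟨g, ⟨(B.hasUniqueMax_iff_discrete hB g).2 hI.discrete, fun j => ?_⟩, rfl⟩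
    rw [← sublevelChain_succ_sdiff, hcard]

theorem zeta_eq_ncard_uniqueMaxMaps {B : FinHypergraph (Fin n)} (hB : B.ground = univ)
    (α : Composition n) : B.zeta α = (uniqueMaxMaps B α).ncard := by
  rw [FinHypergraph.zeta, ← image_sublevelChain_uniqueMaxMaps hB,
    Set.ncard_image_of_injective _ sublevelChain_injective]

theorem image_comp_uniqueMaxMaps (B : FinHypergraph (Fin n)) {α : Composition n}
    {i : Fin α.length → ℕ+} (hi : StrictMono i) :
    (fun g => i ∘ g) '' uniqueMaxMaps B α =
      {f : Fin n → ℕ+ | B.HasUniqueMax f ∧ exponent f = compExponent α i} := by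
  ext f
  constructor
  · rintro ⟨g, ⟨hmax, hcard⟩, rfl⟩
    refine ⟨(B.hasUniqueMax_comp_iff hi g).2 hmax, Finsupp.ext fun a => ?_⟩
    rw [exponent_apply]
    by_cases ha : a ∈ Set.range i
    · obtain ⟨j, rfl⟩ := ha
      simp only [compExponent_apply hi.injective, Function.comp_apply, hi.injective.eq_iff, hcard]
    · rw [compExponent_apply_of_notMem_range ha, card_eq_zero, filter_eq_empty_iff]
      exact fun x _ hx => ha ⟨g x, hx⟩
  · rintro ⟨hmax, hexp⟩
    have hrange : ∀ x, ∃ j, i j = f x := fun x => by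
      rw [← Set.mem_range, ← mem_support_compExponent hi.injective, ← hexp,
        Finsupp.mem_support_iff, exponent_apply]
      exact (card_pos.2 ⟨x, by simp⟩).ne'
    choose g hg using hrange
    obtain rfl : i ∘ g = f := funext hg
    refine ⟨g, ⟨(B.hasUniqueMax_comp_iff hi g).1 hmax, fun j => ?_⟩, rfl⟩
    have := exponent_apply (i ∘ g) (i j)
    simp only [hexp, compExponent_apply hi.injective, Function.comp_apply,
      hi.injective.eq_iff] at this
    exact this.symm

/-! ### Comparison of coefficients. -/

theorem ncard_generic_exponent_eq (B : FinHypergraph (Fin n)) {α : Composition n}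
    {i : Fin α.length → ℕ+} (hi : StrictMono i) :
    {f : {f : Fin n → ℕ+ // IsGeneric B.polytope f} |
      exponent f.1 = compExponent α i}.ncard = (uniqueMaxMaps B α).ncard := by
  have hval : Subtype.val '' {f : {f : Fin n → ℕ+ // IsGeneric B.polytope f} |
      exponent f.1 = compExponent α i} =
      {f : Fin n → ℕ+ | B.HasUniqueMax f ∧ exponent f = compExponent α i} := by
    ext f
    simp [FinHypergraph.isGeneric_polytope_iff, and_comm]
  rw [← Set.ncard_image_of_injective _ Subtype.val_injective, hval,
    ← image_comp_uniqueMaxMaps B hi, Set.ncard_image_of_injective _ hi.injective.comp_left]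

theorem coeff_monomialSum {A : Type*} (m : A → (ℕ+ →₀ ℕ)) (d : ℕ+ →₀ ℕ) :
    MvPowerSeries.coeff d (monomialSum m) = (({a | m a = d} : Set A).ncard : ℤ) :=
  rfl

theorem coeff_monomialQSym_self {α : Composition n} {i : Fin α.length → ℕ+}
    (hi : StrictMono i) : MvPowerSeries.coeff (compExponent α i) (monomialQSym α) = 1 := by
  rw [monomialQSym, coeff_monomialSum, Nat.cast_eq_one, Set.ncard_eq_one]
  refine ⟨⟨i, hi⟩, Set.eq_singleton_iff_unique_mem.2 ⟨rfl, fun j hj => ?_⟩⟩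
  exact Subtype.ext (eq_of_compExponent_eq j.2 hi hj)

theorem coeff_monomialQSym_eq_zero {α : Composition n} {d : ℕ+ →₀ ℕ}
    (h : ∀ i : Fin α.length → ℕ+, StrictMono i → compExponent α i ≠ d) :
    MvPowerSeries.coeff d (monomialQSym α) = 0 := by
  rw [monomialQSym, coeff_monomialSum, Nat.cast_eq_zero]
  have : {i : {i : Fin α.length → ℕ+ // StrictMono i} | compExponent α i.1 = d} = ∅ :=
    Set.eq_empty_of_forall_notMem fun i hi => h i.1 i.2 hi
  rw [this, Set.ncard_empty]

/-- At a monomial of some `M_α` only the `α`-term survives, with coefficient 1; at any other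
monomial both sides vanish, since every `x_f` occurs in some `M_α`. -/
theorem genericEnumerator_polytope {B : FinHypergraph (Fin n)} (hB : B.ground = univ) :
    genericEnumerator B.polytope = ∑ α : Composition n, B.zeta α • monomialQSym α := by
  ext d
  rw [map_sum]
  simp only [map_nsmul]
  by_cases hd : ∃ (α : Composition n) (i : Fin α.length → ℕ+), StrictMono i ∧
      compExponent α i = d
  · obtain ⟨α, i, hi, rfl⟩ := hd
    rw [sum_eq_single α, coeff_monomialQSym_self hi, genericEnumerator, coeff_monomialSum,
      ncard_generic_exponent_eq B hi, zeta_eq_ncard_uniqueMaxMaps hB, nsmul_one]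
    · intro β _ hβ
      rw [coeff_monomialQSym_eq_zero, smul_zero]
      exact fun j hj h => hβ (composition_eq_of_compExponent_eq hj hi h)
    · exact fun h => absurd (mem_univ α) h
  · push Not at hd
    rw [sum_eq_zero, genericEnumerator, coeff_monomialSum, Nat.cast_eq_zero]
    · have : {f : {f : Fin n → ℕ+ // IsGeneric B.polytope f} | exponent f.1 = d} = ∅ := by
        refine Set.eq_empty_of_forall_notMem fun f hf => ?_
        obtain ⟨α, i, hi, h⟩ := exists_compExponent_eq_exponent f.1
        exact hd α i hi (h.trans hf)
      rw [this, Set.ncard_empty]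
    · exact fun α _ => by rw [coeff_monomialQSym_eq_zero (hd α), smul_zero]

end Chains

end Nestohedra

theorem mainTheorem2 {n : ℕ} (B : Nestohedra.FinHypergraph (Fin n))
    (hground : B.ground = Finset.univ) (hbuilding : B.IsBuildingSet)
    (hconn : B.IsConnected) :
    Nestohedra.genericEnumerator B.polytope =
      ∑ α : Composition n, B.zeta α • Nestohedra.monomialQSym α := by
  exact Nestohedra.genericEnumerator_polytope hground
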